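/- Let $A$ be a locally compact Hausdorff abelian group with dual group $\widehat A$ (the continuous homomorphisms from $A$ to the circle group $\mathbb T$, with the compact-open topology), pairing $\langle x,\xi\rangle=\xi(x)\in\mathbb T$, both group laws written additively, and fix a Haar measure on $A$. For $(x,\xi)\in A\times\widehat A$ and $f\in L^2(A)$ put $$\pi(x,\xi)f(y)=\langle y,\xi\rangle f(y-x),\qquad V_f f(x,\xi)=\langle f,\pi(x,\xi)f\rangle_{L^2(A)}=\int_A \overline{\langle y,\xi\rangle}\,f(y)\,\overline{f(y-x)}\,dy .$$ A subgroup $G\subset A\times\widehat A$ is called isotropic if $\langle y,\xi\rangle\overline{\langle x,\eta\rangle}=1$ for all $(x,\xi),(y,\eta)\in G$. Given a topological abelian group $B$ and a continuous homomorphism $\phi:B\to\widehat B$ that is symmetric, i.e. $\langle x,\phi(y)\rangle=\langle y,\phi(x)\rangle$ for all $x,y\in B$, a character of second degree of $B$ associated to $\phi$ is a continuous function $h:B\to\mathbb T$ with $h(x+y)=h(x)h(y)\langle x,\phi(y)\rangle$ for all $x,y\in B$. Let $f\in L^2(A)\setminus\{0\}$. Then $|V_f f(z)|\le V_f f(0)=\|f\|_{L^2(A)}^2$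 for every $z\in A\times\widehat A$. Let $$G=\{z\in A\times\widehat A:\ |V_f f(z)|=V_f f(0)\}.$$ Then: 1. $G$ is a compact isotropic subgroup of $A\times\widehat A$. 2. The formula $\langle (x,\xi),\phi'(y,\eta)\rangle=\overline{\langle x,\eta\rangle}$, for $(x,\xi),(y,\eta)\in G$, defines a continuous symmetric homomorphism $\phi':G\to\widehat G$, and the restriction of $\|f\|_{L^2(A)}^{-2}V_f f$ to $G$ is a character of second degree of $G$ associated to $\phi'$. 3. For all $(x,\xi)\in G$ and $(y,\eta)\in A\times\widehat A$, $$V_f f(y+x,\eta+\xi)=\|f\|_{L^2(A)}^{-2}\,V_f f(x,\xi)\,V_f f(y,\eta)\,\overline{\langle x,\eta\rangle}.$$ 4. $|V_f f|$ is constant on every coset of $G$ in $A\times\widehat A$. -/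

import Mathlib

open MeasureTheory ComplexConjugate
open scoped Pointwise

/- Locally compact abelian groups are written multiplicatively, so that the dual group is Mathlib's
`PontryaginDual A`; for `x : A` and `ξ : PontryaginDual A` the pairing `⟨x, ξ⟩` is `ξ x : Circle`.
The neutral element of `A × PontryaginDual A` is `1`. -/

noncomputable section

namespace TimeFrequency

section Operators

variable {A : Type*} [CommGroup A] [TopologicalSpace A] [IsTopologicalGroup A]
  [MeasurableSpace A] [BorelSpace A] {μ : Measure A} [μ.IsHaarMeasure]

theorem memLp_translate (x : A) (f : Lp ℂ 2 μ) : MemLp (fun y : A => f (x⁻¹ * y)) 2 μ :=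
  (Lp.memLp f).comp_measurePreserving (measurePreserving_mul_left μ x⁻¹)

theorem memLp_modulate (ξ : PontryaginDual A) (f : Lp ℂ 2 μ) :
    MemLp (fun y : A => (ξ y : ℂ) * f y) 2 μ := by
  refine (Lp.memLp f).of_le ?_ (Filter.Eventually.of_forall fun y => by
    rw [norm_mul, Circle.norm_coe, one_mul])
  exact (continuous_subtype_val.comp (map_continuous ξ) :
    Continuous fun y : A => (ξ y : ℂ)).aestronglyMeasurable.mul
    (Lp.aestronglyMeasurable f)

/-- The translation `T_x f (y) = f (y - x)` on `L²(A)` (in multiplicative notation `f (x⁻¹ y)`). -/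
def translation (x : A) (f : Lp ℂ 2 μ) : Lp ℂ 2 μ :=
  (memLp_translate x f).toLp _

/-- The modulation `M_ξ f (y) = ⟨y, ξ⟩ f (y)` on `L²(A)`. -/
def modulation (ξ : PontryaginDual A) (f : Lp ℂ 2 μ) : Lp ℂ 2 μ :=
  (memLp_modulate ξ f).toLp _

/-- The time-frequency shift `π(x, ξ) = M_ξ T_x`. -/
def tfShift (z : A × PontryaginDual A) (f : Lp ℂ 2 μ) : Lp ℂ 2 μ :=
  modulation z.2 (translation z.1 f)

/-- The short-time Fourier transform `V_g f (z) = ⟨f, π(z) g⟩` of `f` with window `g`.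
The inner product of the text is linear in its first argument, that of Mathlib in the second. -/
def stft (g f : Lp ℂ 2 μ) (z : A × PontryaginDual A) : ℂ :=
  inner ℂ (tfShift z g) f

/-- The set of the `z` such that `|V_f f (z)| = V_f f (0)`. -/
def ambiguityMaxSet (f : Lp ℂ 2 μ) : Set (A × PontryaginDual A) :=
  {z | (‖stft f f z‖ : ℂ) = stft f f 1}

end Operators

section Groups

variable {A : Type*} [CommGroup A] [TopologicalSpace A]

/-- The standard symplectic bicharacter `σ((x, ξ), (y, η)) = ⟨y, ξ⟩ * conj ⟨x, η⟩`
of `A × PontryaginDual A`; on the unit circle, conjugation is inversion. -/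
def symplectic (z w : A × PontryaginDual A) : Circle :=
  z.2 w.1 * (w.2 z.1)⁻¹

/-- A subgroup is isotropic if `σ` is trivial on it. -/
def IsIsotropic (G : Subgroup (A × PontryaginDual A)) : Prop :=
  ∀ z ∈ G, ∀ w ∈ G, symplectic z w = 1

/-- A continuous homomorphism `φ : B → B^` is symmetric if `⟨x, φ y⟩ = ⟨y, φ x⟩`. -/
def IsSymmetricHom {B : Type*} [CommGroup B] [TopologicalSpace B]
    (φ : B →ₜ* PontryaginDual B) : Prop :=
  ∀ x y : B, φ y x = φ x y

/-- `h : B → 𝕋` is a character of second degree of `B` associated to the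
continuous symmetric homomorphism `φ : B → B^`. -/
structure IsSecondDegreeCharacter {B : Type*} [CommGroup B] [TopologicalSpace B]
    (φ : B →ₜ* PontryaginDual B) (h : B → Circle) : Prop where
  symmetric : IsSymmetricHom φ
  continuous : Continuous h
  map_mul : ∀ x y : B, h (x * y) = h x * h y * φ y x

/-- The inclusion of a subgroup, as a continuous homomorphism. -/
def inclusion (G : Subgroup (A × PontryaginDual A)) : G →ₜ* A × PontryaginDual A where
  toMonoidHom := G.subtype
  continuous_toFun := continuous_subtype_val

/-- The continuous homomorphism `φ' : G → G^` with `⟨(x, ξ), φ'(y, η)⟩ = conj ⟨x, η⟩`: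
`φ'(y, η)` is the pull-back of the inverse character of `η` under the first projection `G → A`. -/
def phaseHom (G : Subgroup (A × PontryaginDual A)) : G →ₜ* PontryaginDual G :=
  (PontryaginDual.map ((ContinuousMonoidHom.fst A (PontryaginDual A)).comp (inclusion G))).comp
    ((ContinuousMonoidHom.inv (PontryaginDual A)).comp
      ((ContinuousMonoidHom.snd A (PontryaginDual A)).comp (inclusion G)))

theorem phaseHom_apply (G : Subgroup (A × PontryaginDual A)) (z w : G) :
    (phaseHom G w z : ℂ) = conj (w.1.2 z.1.1 : ℂ) := by
  rw [← Circle.coe_inv_eq_conj]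
  rfl

end Groups

end TimeFrequency

end

namespace TimeFrequency

open Filter Topology

/-! ### Commutation relations of time-frequency shifts, and their eigenvectors. -/

section Algebra

variable {A : Type*} [CommGroup A] [TopologicalSpace A] [IsTopologicalGroup A]
  [MeasurableSpace A] [BorelSpace A] {μ : Measure A} [μ.IsHaarMeasure]

/-! The shifts `π(z)` are unitary and compose up to a unimodular phase. By the equality case of
Cauchy-Schwarz, `|V_f f|` is maximal at `z` exactly when `f` is an eigenvector of `π(z)`
(`mem_ambiguityMaxSet_iff`); so `G` stabilizes the line `ℂ f` and is a subgroup, and pulling the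
eigenvalue out of the inner product gives the functional equation. Comparing `π(z)π(w)f` with
`π(w)π(z)f` shows that `z ∈ G` is `σ`-orthogonal to every `w` with `V_f f(w) ≠ 0`, in particular to
`G`.

For compactness, `G` is closed because `V_f f` is continuous. Its first coordinates stay in a
compact set, since `f` is nearly orthogonal to its far translates. Since `V_f f(u, 1) ≠ 0` for `u`
near `1`, `σ`-orthogonality makes every `ξ` occurring in `G` trivial on one fixed neighbourhood of
`1`; such characters lie in the image of the compact dual of a discrete quotient. -/

theorem coeFn_translation (x : A) (f : Lp ℂ 2 μ) :
    translation x f =ᵐ[μ] fun y => f (x⁻¹ * y) :=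
  MemLp.coeFn_toLp _

theorem coeFn_modulation (ξ : PontryaginDual A) (f : Lp ℂ 2 μ) :
    modulation ξ f =ᵐ[μ] fun y => (ξ y : ℂ) * f y :=
  MemLp.coeFn_toLp _

theorem coeFn_tfShift (z : A × PontryaginDual A) (f : Lp ℂ 2 μ) :
    tfShift z f =ᵐ[μ] fun y => (z.2 y : ℂ) * f (z.1⁻¹ * y) := by
  filter_upwards [coeFn_modulation z.2 (translation z.1 f), coeFn_translation z.1 f] with y h h'
  rw [tfShift, h, h']

theorem coeFn_comp_mul_left {E : Type*} (x : A) {f g : A → E} (h : f =ᵐ[μ] g) :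
    (fun y => f (x * y)) =ᵐ[μ] fun y => g (x * y) :=
  (measurePreserving_mul_left μ x).quasiMeasurePreserving.ae_eq_comp h

theorem tfShift_smul (z : A × PontryaginDual A) (c : ℂ) (f : Lp ℂ 2 μ) :
    tfShift z (c • f) = c • tfShift z f := by
  apply Lp.ext
  filter_upwards [coeFn_tfShift z (c • f), Lp.coeFn_smul c (tfShift z f), coeFn_tfShift z f,
    coeFn_comp_mul_left z.1⁻¹ (Lp.coeFn_smul c f)] with y h₁ h₂ h₃ h₄
  rw [h₁, h₂, h₄, Pi.smul_apply, Pi.smul_apply, h₃]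
  simp only [smul_eq_mul]
  ring

theorem tfShift_one (f : Lp ℂ 2 μ) : tfShift 1 f = f := by
  apply Lp.ext
  filter_upwards [coeFn_tfShift 1 f] with y h
  rw [h]
  simp

theorem tfShift_tfShift (z w : A × PontryaginDual A) (f : Lp ℂ 2 μ) :
    tfShift z (tfShift w f) = conj (w.2 z.1 : ℂ) • tfShift (z * w) f := by
  apply Lp.ext
  filter_upwards [coeFn_tfShift z (tfShift w f), coeFn_tfShift (z * w) f,
    Lp.coeFn_smul (conj (w.2 z.1 : ℂ)) (tfShift (z * w) f),
    coeFn_comp_mul_left z.1⁻¹ (coeFn_tfShift w f)] with y h₁ h₂ h₃ h₄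
  rw [h₁, h₃, h₄, Pi.smul_apply, h₂, smul_eq_mul, ← Circle.coe_inv_eq_conj]
  have e : (z * w).1⁻¹ * y = w.1⁻¹ * (z.1⁻¹ * y) := by
    rw [Prod.fst_mul, mul_inv_rev, mul_assoc]
  have e' : (z * w).2 y = z.2 y * w.2 y := rfl
  rw [e, e', map_mul, map_inv]
  push_cast
  ring

theorem inner_tfShift_tfShift (z : A × PontryaginDual A) (f g : Lp ℂ 2 μ) :
    inner ℂ (tfShift z f) (tfShift z g) = inner ℂ f g := by
  rw [L2.inner_def, L2.inner_def,
    ← integral_mul_left_eq_self (fun y => inner ℂ (f y) (g y)) z.1⁻¹]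
  apply integral_congr_ae
  filter_upwards [coeFn_tfShift z f, coeFn_tfShift z g] with y h h'
  rw [h, h']
  have : conj (z.2 y : ℂ) * (z.2 y : ℂ) = 1 := by
    rw [← Circle.coe_inv_eq_conj, ← Circle.coe_mul, inv_mul_cancel, Circle.coe_one]
  simp only [RCLike.inner_apply, map_mul]
  linear_combination g (z.1⁻¹ * y) * conj (f (z.1⁻¹ * y)) * this

theorem norm_tfShift (z : A × PontryaginDual A) (f : Lp ℂ 2 μ) : ‖tfShift z f‖ = ‖f‖ := by
  rw [norm_eq_sqrt_re_inner (𝕜 := ℂ), inner_tfShift_tfShift, ← norm_eq_sqrt_re_inner]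

theorem norm_tfShift_sub_tfShift (z : A × PontryaginDual A) (f g : Lp ℂ 2 μ) :
    ‖tfShift z f - tfShift z g‖ = ‖f - g‖ := by
  rw [norm_eq_sqrt_re_inner (𝕜 := ℂ), norm_eq_sqrt_re_inner (𝕜 := ℂ) (f - g)]
  simp only [inner_sub_left, inner_sub_right, inner_tfShift_tfShift]

theorem tfShift_one_snd (ξ : PontryaginDual A) (f : Lp ℂ 2 μ) :
    tfShift (1, ξ) f = modulation ξ f := by
  apply Lp.ext
  filter_upwards [coeFn_tfShift (1, ξ) f, coeFn_modulation ξ f] with y h h'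
  rw [h, h']
  simp

theorem stft_self_one (f : Lp ℂ 2 μ) : stft f f 1 = ((‖f‖ ^ 2 : ℝ) : ℂ) := by
  rw [stft, tfShift_one, inner_self_eq_norm_sq_to_K]
  push_cast
  rfl

theorem norm_stft_le (g f : Lp ℂ 2 μ) (z : A × PontryaginDual A) :
    ‖stft g f z‖ ≤ ‖g‖ * ‖f‖ := by
  simpa only [stft, norm_tfShift] using norm_inner_le_norm (𝕜 := ℂ) (tfShift z g) f

theorem mem_ambiguityMaxSet_iff_norm_eq {f : Lp ℂ 2 μ} {z : A × PontryaginDual A} :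
    z ∈ ambiguityMaxSet f ↔ ‖stft f f z‖ = ‖f‖ ^ 2 := by
  change (‖stft f f z‖ : ℂ) = stft f f 1 ↔ _
  rw [stft_self_one]
  norm_cast

theorem stft_eq_of_tfShift_eq_smul {f : Lp ℂ 2 μ} {z : A × PontryaginDual A} {c : ℂ}
    (h : tfShift z f = c • f) : stft f f z = conj c * (‖f‖ ^ 2 : ℝ) := by
  rw [stft, h, inner_smul_left, ← stft_self_one, stft, tfShift_one]

/-- The ambiguity function attains its maximal modulus exactly at the shifts having `f` as an
eigenvector, by the equality case of the Cauchy-Schwarz inequality. -/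
theorem mem_ambiguityMaxSet_iff {f : Lp ℂ 2 μ} (hf : f ≠ 0) {z : A × PontryaginDual A} :
    z ∈ ambiguityMaxSet f ↔ ∃ c : Circle, tfShift z f = (c : ℂ) • f := by
  have hn : ‖f‖ ≠ 0 := norm_ne_zero_iff.2 hf
  rw [mem_ambiguityMaxSet_iff_norm_eq]
  constructor
  · intro h
    have hz : tfShift z f ≠ 0 := by
      rw [← norm_ne_zero_iff, norm_tfShift]
      exact hn
    have h' : ‖inner ℂ f (tfShift z f)‖ = ‖f‖ * ‖tfShift z f‖ := by
      rw [norm_inner_symm, norm_tfShift, ← pow_two]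
      exact h
    have key := (norm_inner_eq_norm_tfae ℂ f (tfShift z f)).out 0 2
    obtain ⟨c, hc⟩ := (key.1 h').resolve_left hf
    have hc1 : ‖c‖ = 1 := by
      have := congrArg norm hc
      rw [norm_tfShift, norm_smul] at this
      exact (mul_eq_right₀ hn).1 this.symm
    exact ⟨⟨c, mem_sphere_zero_iff_norm.2 hc1⟩, hc⟩
  · rintro ⟨c, hc⟩
    rw [stft_eq_of_tfShift_eq_smul hc, norm_mul, RCLike.norm_conj, Circle.norm_coe, one_mul,
      Complex.norm_real, Real.norm_of_nonneg (by positivity)]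

theorem circle_coe_mul_conj (c : Circle) : (c : ℂ) * conj (c : ℂ) = 1 := by
  rw [← Circle.coe_inv_eq_conj, ← Circle.coe_mul, mul_inv_cancel, Circle.coe_one]

theorem tfShift_mul (z w : A × PontryaginDual A) (f : Lp ℂ 2 μ) :
    tfShift (z * w) f = (w.2 z.1 : ℂ) • tfShift z (tfShift w f) := by
  rw [tfShift_tfShift, smul_smul, circle_coe_mul_conj, one_smul]

/-- Writing the second argument `f` as `conj c • π(z) f` lets unitarity cancel `π(z)` from both
arguments. -/
theorem stft_mul_of_tfShift_eq_smul {f : Lp ℂ 2 μ} (hf : f ≠ 0) {z : A × PontryaginDual A}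
    {c : Circle} (h : tfShift z f = (c : ℂ) • f) (w : A × PontryaginDual A) :
    stft f f (w * z) =
      (((‖f‖ ^ 2)⁻¹ : ℝ) : ℂ) * stft f f z * stft f f w * conj (w.2 z.1 : ℂ) := by
  have hn : ((‖f‖ ^ 2 : ℝ) : ℂ) ≠ 0 := by
    simpa using hf
  have h1 : f = conj (c : ℂ) • tfShift z f := by
    rw [h, smul_smul, mul_comm, circle_coe_mul_conj, one_smul]
  have h2 : inner ℂ (tfShift z (tfShift w f)) f = conj (c : ℂ) * stft f f w := by
    nth_rw 2 [h1]
    rw [inner_smul_right, inner_tfShift_tfShift, stft]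
  rw [mul_comm w z, stft, tfShift_mul, inner_smul_left, h2, stft_eq_of_tfShift_eq_smul h,
    Complex.ofReal_inv]
  field_simp

/-- The stabilizer of the line spanned by `f`. -/
def ambiguityMaxSubgroup (f : Lp ℂ 2 μ) (hf : f ≠ 0) : Subgroup (A × PontryaginDual A) where
  carrier := ambiguityMaxSet f
  one_mem' := (mem_ambiguityMaxSet_iff hf).2 ⟨1, by rw [tfShift_one]; simp⟩
  mul_mem' := by
    intro z w hz hw
    obtain ⟨c, hc⟩ := (mem_ambiguityMaxSet_iff hf).1 hz
    obtain ⟨d, hd⟩ := (mem_ambiguityMaxSet_iff hf).1 hw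
    refine (mem_ambiguityMaxSet_iff hf).2 ⟨w.2 z.1 * d * c, ?_⟩
    rw [tfShift_mul, hd, tfShift_smul, hc, smul_smul, smul_smul, Circle.coe_mul, Circle.coe_mul]
  inv_mem' := by
    intro z hz
    obtain ⟨c, hc⟩ := (mem_ambiguityMaxSet_iff hf).1 hz
    -- The eigenvalue is forced by expanding `π(z⁻¹ z) f = f`.
    refine (mem_ambiguityMaxSet_iff hf).2 ⟨(z.2 z.1⁻¹ * c)⁻¹, ?_⟩
    have h : ((z.2 z.1⁻¹ * c : Circle) : ℂ) • tfShift z⁻¹ f = f := by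
      have := tfShift_mul z⁻¹ z f
      rw [inv_mul_cancel, tfShift_one, hc, tfShift_smul, smul_smul] at this
      exact this.symm
    nth_rw 2 [← h]
    rw [smul_smul, ← Circle.coe_mul, inv_mul_cancel, Circle.coe_one, one_smul]

theorem mem_ambiguityMaxSubgroup {f : Lp ℂ 2 μ} {hf : f ≠ 0} {z : A × PontryaginDual A} :
    z ∈ ambiguityMaxSubgroup f hf ↔ ∃ c : Circle, tfShift z f = (c : ℂ) • f :=
  mem_ambiguityMaxSet_iff hf

/-- An eigenfunction of `π(z)` is not orthogonal to its shift by `w` only if `π(z)` and `π(w)`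
commute. -/
theorem symplectic_eq_one_of_stft_ne_zero {f : Lp ℂ 2 μ} {z w : A × PontryaginDual A} {c : Circle}
    (h : tfShift z f = (c : ℂ) • f) (hw : stft f f w ≠ 0) : symplectic z w = 1 := by
  have h1 : inner ℂ (tfShift z (tfShift w f)) (tfShift z f) = stft f f w :=
    inner_tfShift_tfShift _ _ _
  have h2 : tfShift w (tfShift z f) = (c : ℂ) • tfShift w f := by rw [h, tfShift_smul]
  -- A factor `1`, split as phase times conjugate, refolds `π(wz)f` into `π(w)π(z)f = c π(w)f`.
  rw [tfShift_tfShift, mul_comm, ← one_smul ℂ (tfShift (w * z) f),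
    ← circle_coe_mul_conj (z.2 w.1), mul_smul, ← tfShift_tfShift, h2, h, smul_smul, smul_smul,
    inner_smul_left, inner_smul_right] at h1
  change _ * (_ * stft f f w) = _ at h1
  have h3 : (conj (conj (w.2 z.1 : ℂ) * (z.2 w.1 : ℂ) * c) * c : ℂ) = 1 :=
    mul_right_cancel₀ hw (by rw [one_mul, mul_assoc]; exact h1)
  have h4 : (w.2 z.1 : ℂ) * conj (z.2 w.1 : ℂ) = 1 := by
    simp only [map_mul, Complex.conj_conj] at h3
    linear_combination h3 - (w.2 z.1 : ℂ) * conj (z.2 w.1 : ℂ) * circle_coe_mul_conj c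
  rw [← Circle.coe_inv_eq_conj, ← Circle.coe_mul, Circle.coe_eq_one, mul_inv_eq_one] at h4
  rw [symplectic, h4, mul_inv_cancel]

theorem isIsotropic_ambiguityMaxSubgroup (f : Lp ℂ 2 μ) (hf : f ≠ 0) :
    IsIsotropic (ambiguityMaxSubgroup f hf) := by
  intro z hz w hw
  obtain ⟨c, hc⟩ := mem_ambiguityMaxSubgroup.1 hz
  refine symplectic_eq_one_of_stft_ne_zero hc fun h0 => ?_
  have := mem_ambiguityMaxSet_iff_norm_eq.1 hw
  rw [h0, norm_zero] at this
  exact hf (by simpa using this.symm)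

end Algebra

/-! ### Strong continuity of the time-frequency shifts. -/

section Continuity

variable {A : Type*} [CommGroup A] [TopologicalSpace A] [IsTopologicalGroup A]
  [LocallyCompactSpace A] [MeasurableSpace A] [BorelSpace A]
  {μ : Measure A} [μ.IsHaarMeasure] [μ.Regular]

theorem continuous_translation (f : Lp ℂ 2 μ) : Continuous fun x : A => translation x f := by
  -- `DomMulAct.mk a` acts by `f ↦ f (a * ·)`, hence the inverse.
  have h : (fun x : A => translation x f) = fun x => DomMulAct.mk x⁻¹ • f := by
    funext x
    apply Lp.ext
    filter_upwards [coeFn_translation x f, DomMulAct.smul_Lp_ae_eq (DomMulAct.mk x⁻¹) f]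
      with y h h'
    rw [h, h']
    simp
  rw [h]
  have : Fact ((2 : ENNReal) ≠ ⊤) := ⟨by simp⟩
  exact (DomMulAct.continuous_mk.comp continuous_inv).smul continuous_const

-- Inner regularity handles indicators of sets of finite measure; sums and density do the rest.
omit [CommGroup A] [IsTopologicalGroup A] [LocallyCompactSpace A] [μ.IsHaarMeasure] in
theorem exists_isCompact_eLpNorm_sub_le [R1Space A] {f : A → ℂ} (hf : MemLp f 2 μ)
    {ε : ENNReal} (hε : ε ≠ 0) :
    ∃ g : A → ℂ, eLpNorm (f - g) 2 μ ≤ ε ∧ MemLp g 2 μ ∧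
      ∃ K : Set A, IsCompact K ∧ ∀ y ∉ K, g y = 0 := by
  refine hf.induction_dense (by simp) _ ?_ ?_ (fun g hg => hg.1.aestronglyMeasurable) hε
  · intro c t ht htμ ε hε
    obtain ⟨η, ηpos, hη⟩ := exists_eLpNorm_indicator_le (μ := μ) (p := 2) (by simp) c hε
    obtain ⟨s, st, hsc, hs, hμs⟩ := ht.exists_isCompact_isClosed_sdiff_lt htμ.ne
      (ENNReal.coe_pos.2 ηpos).ne'
    refine ⟨s.indicator fun _ => c, ?_, ?_, s, hsc, fun y hy => Set.indicator_of_notMem hy _⟩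
    · rw [← eLpNorm_neg, neg_sub, ← Set.indicator_sdiff st]
      exact hη _ hμs.le
    · exact memLp_indicator_const 2 hs.measurableSet c
        (Or.inr ((measure_mono st).trans_lt htμ).ne)
  · rintro g h ⟨hg, K, hK, hgK⟩ ⟨hh, L, hL, hhL⟩
    refine ⟨hg.add hh, K ∪ L, hK.union hL, fun y hy => ?_⟩
    rw [Set.mem_union, not_or] at hy
    rw [Pi.add_apply, hgK y hy.1, hhL y hy.2, add_zero]

omit [LocallyCompactSpace A] [μ.IsHaarMeasure] in
theorem exists_isCompact_norm_sub_le (f : Lp ℂ 2 μ) {ε : ℝ} (hε : 0 < ε) :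
    ∃ g : Lp ℂ 2 μ, ‖f - g‖ ≤ ε ∧ ∃ K : Set A, IsCompact K ∧ ∀ᵐ y ∂μ, y ∉ K → g y = 0 := by
  obtain ⟨g, hg, hgm, K, hK, hgK⟩ := exists_isCompact_eLpNorm_sub_le (Lp.memLp f)
    (ε := ENNReal.ofReal ε) (by simpa using hε)
  refine ⟨hgm.toLp g, ?_, K, hK, ?_⟩
  · have : f - hgm.toLp g = ((Lp.memLp f).sub hgm).toLp _ := by
      rw [MemLp.toLp_sub (Lp.memLp f) hgm, Lp.toLp_coeFn]
    rw [this, Lp.norm_toLp]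
    exact ENNReal.toReal_le_of_le_ofReal hε.le hg
  · filter_upwards [hgm.coeFn_toLp] with y hy hyK
    rw [hy, hgK y hyK]

omit [LocallyCompactSpace A] [μ.Regular] in
theorem norm_modulation_sub_le {f : Lp ℂ 2 μ} {K : Set A} (hK : ∀ᵐ y ∂μ, y ∉ K → f y = 0)
    {ξ η : PontryaginDual A} {δ : ℝ} (h : ∀ y ∈ K, dist (ξ y) (η y) ≤ δ) :
    ‖modulation ξ f - modulation η f‖ ≤ δ * ‖f‖ := by
  apply Lp.norm_le_mul_norm_of_ae_le_mul
  filter_upwards [Lp.coeFn_sub (modulation ξ f) (modulation η f), coeFn_modulation ξ f,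
    coeFn_modulation η f, hK] with y h₁ h₂ h₃ h₄
  rw [h₁, Pi.sub_apply, h₂, h₃, ← sub_mul, norm_mul]
  by_cases hy : y ∈ K
  · rw [← dist_eq_norm]
    exact mul_le_mul_of_nonneg_right (h y hy) (norm_nonneg _)
  · simp [h₄ hy]

-- Convergence in the compact-open topology is uniform on `K`, the only place where `f` lives.
omit [LocallyCompactSpace A] [μ.Regular] in
theorem continuous_modulation_of_compact {f : Lp ℂ 2 μ} {K : Set A} (hKc : IsCompact K)
    (hK : ∀ᵐ y ∂μ, y ∉ K → f y = 0) :
    Continuous fun ξ : PontryaginDual A => modulation ξ f := by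
  refine Metric.continuous_iff'.2 fun η ε hε => ?_
  have hδ : 0 < ε / (‖f‖ + 1) := by positivity
  have hc : Tendsto (fun ξ : PontryaginDual A => ContinuousMonoidHom.toContinuousMap ξ) (𝓝 η)
      (𝓝 (ContinuousMonoidHom.toContinuousMap η)) :=
    (ContinuousMonoidHom.isInducing_toContinuousMap A Circle).continuous.tendsto η
  have hu := ContinuousMap.tendsto_iff_forall_isCompact_tendstoUniformlyOn.1 hc K hKc
  filter_upwards [Metric.tendstoUniformlyOn_iff.1 hu _ hδ] with ξ hξ
  rw [dist_eq_norm]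
  refine (norm_modulation_sub_le hK (δ := ε / (‖f‖ + 1)) fun y hy => ?_).trans_lt ?_
  · rw [dist_comm]
    exact (hξ y hy).le
  · rw [div_mul_eq_mul_div, div_lt_iff₀ (by positivity)]
    nlinarith [norm_nonneg f]

-- Modulations are isometries, so approximating `f` is uniform in `ξ`.
omit [LocallyCompactSpace A] in
theorem continuous_modulation (f : Lp ℂ 2 μ) :
    Continuous fun ξ : PontryaginDual A => modulation ξ f := by
  refine continuous_of_uniform_approx_of_continuous fun u hu => ?_
  obtain ⟨ε, hε, hεu⟩ := Metric.mem_uniformity_dist.1 hu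
  obtain ⟨g, hg, K, hKc, hK⟩ := exists_isCompact_norm_sub_le f (half_pos hε)
  refine ⟨_, continuous_modulation_of_compact hKc hK, fun ξ => hεu ?_⟩
  rw [dist_eq_norm, ← tfShift_one_snd, ← tfShift_one_snd, norm_tfShift_sub_tfShift]
  linarith

theorem continuous_tfShift (f : Lp ℂ 2 μ) :
    Continuous fun z : A × PontryaginDual A => tfShift z f := by
  refine continuous_iff_continuousAt.2 fun w => ?_
  rw [ContinuousAt]
  refine tendsto_iff_norm_sub_tendsto_zero.2 ?_
  have h1 : Tendsto (fun z : A × PontryaginDual A => ‖translation z.1 f - translation w.1 f‖)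
      (𝓝 w) (𝓝 0) :=
    tendsto_iff_norm_sub_tendsto_zero.1 (((continuous_translation f).comp continuous_fst).tendsto w)
  have h2 : Tendsto (fun z : A × PontryaginDual A =>
      ‖modulation z.2 (translation w.1 f) - modulation w.2 (translation w.1 f)‖)
      (𝓝 w) (𝓝 0) :=
    tendsto_iff_norm_sub_tendsto_zero.1
      (((continuous_modulation (translation w.1 f)).comp continuous_snd).tendsto w)
  refine squeeze_zero (fun _ => norm_nonneg _) (fun z => ?_) 
    ((h1.add h2).trans_eq (by rw [add_zero]))
  rw [← norm_tfShift_sub_tfShift (1, z.2) (translation z.1 f), tfShift_one_snd, tfShift_one_snd]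
  exact norm_sub_le_norm_sub_add_norm_sub (modulation z.2 (translation z.1 f))
    (modulation z.2 (translation w.1 f)) (modulation w.2 (translation w.1 f))

theorem continuous_stft (g f : Lp ℂ 2 μ) : Continuous (stft g f) :=
  (continuous_tfShift g).inner continuous_const

/-! ### Compactness of the maximum set. -/

theorem isClosed_ambiguityMaxSet (f : Lp ℂ 2 μ) : IsClosed (ambiguityMaxSet f) :=
  isClosed_eq (Complex.continuous_ofReal.comp (continuous_stft f f).norm) continuous_const

omit [LocallyCompactSpace A] in
/-- The first projection of `ambiguityMaxSet f` is relatively compact. -/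
theorem exists_isCompact_fst_mem (f : Lp ℂ 2 μ) (hf : f ≠ 0) :
    ∃ K : Set A, IsCompact K ∧ ∀ z ∈ ambiguityMaxSet f, z.1 ∈ K := by
  have hn : 0 < ‖f‖ := norm_pos_iff.2 hf
  obtain ⟨g, hg, K, hKc, hK⟩ := exists_isCompact_norm_sub_le f (ε := ‖f‖ / 4) (by positivity)
  -- Off `K * K⁻¹`, the translate of `K` by `z.1` misses `K`, so `V_g g(z) = 0`. The error `‖f‖ / 4`
  -- then leaves `|V_f f(z)| ≤ (1/4 + 5/16) ‖f‖²`, below the maximum.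
  refine ⟨K * K⁻¹, hKc.mul hKc.inv, fun z hz => ?_⟩
  by_contra hzK
  have h0 : stft g g z = 0 := by
    rw [stft, L2.inner_def]
    refine integral_eq_zero_of_ae ?_
    filter_upwards [coeFn_tfShift z g, hK,
      (measurePreserving_mul_left μ z.1⁻¹).quasiMeasurePreserving.ae hK] with y h₁ h₂ h₃
    by_cases hy : y ∈ K
    · have : z.1⁻¹ * y ∉ K := fun h =>
        hzK ⟨y, hy, (z.1⁻¹ * y)⁻¹, Set.inv_mem_inv.2 h, by simp⟩
      rw [h₁, h₃ this]
      simp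
    · rw [h₂ hy]
      simp
  have h1 : stft f f z = inner ℂ (tfShift z f) (f - g) +
      inner ℂ (tfShift z f - tfShift z g) g := by
    rw [inner_sub_left, inner_sub_right]
    change _ = _ + (_ - stft g g z)
    rw [h0, stft]
    ring
  have h2 : ‖stft f f z‖ ≤ ‖f‖ * ‖f - g‖ + ‖f - g‖ * ‖g‖ := by
    rw [h1]
    refine (norm_add_le _ _).trans (add_le_add ?_ ?_)
    · simpa only [norm_tfShift] using norm_inner_le_norm (𝕜 := ℂ) (tfShift z f) (f - g)
    · simpa only [norm_tfShift_sub_tfShift] using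
        norm_inner_le_norm (𝕜 := ℂ) (tfShift z f - tfShift z g) g
  have h3 : ‖g‖ ≤ ‖f‖ + ‖f‖ / 4 := by
    have := norm_sub_norm_le g f
    rw [norm_sub_rev] at this
    linarith
  rw [mem_ambiguityMaxSet_iff_norm_eq.1 hz] at h2
  nlinarith [norm_nonneg g, norm_nonneg (f - g)]

omit [LocallyCompactSpace A] [MeasurableSpace A] [BorelSpace A] in
/-- The characters that are trivial on a given neighbourhood of `1` form a relatively compact
set. -/
theorem exists_isCompact_of_eq_one {U : Set A} (hU : U ∈ 𝓝 (1 : A)) :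
    ∃ L : Set (PontryaginDual A), IsCompact L ∧
      ∀ ξ : PontryaginDual A, (∀ u ∈ U, ξ u = 1) → ξ ∈ L := by
  let H : Subgroup A := Subgroup.closure U
  have hH : IsOpen (H : Set A) :=
    H.isOpen_of_mem_nhds (Filter.mem_of_superset hU Subgroup.subset_closure)
  have : DiscreteTopology (A ⧸ H) := QuotientGroup.discreteTopology hH
  let q : A →ₜ* A ⧸ H := ⟨QuotientGroup.mk' H, QuotientGroup.continuous_mk⟩
  -- The dual of the discrete group `A ⧸ H` is compact, and `ξ` factors through `q`.
  refine ⟨Set.range (PontryaginDual.map q), isCompact_range (map_continuous _), fun ξ hξ => ?_⟩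
  have hle : H ≤ (ξ : A →* Circle).ker := (Subgroup.closure_le _).2 hξ
  let ψ : PontryaginDual (A ⧸ H) :=
    (⟨QuotientGroup.lift H (ξ : A →* Circle) hle, continuous_of_discreteTopology⟩ :
      A ⧸ H →ₜ* Circle)
  exact ⟨ψ, PontryaginDual.ext fun a => rfl⟩

theorem isCompact_ambiguityMaxSet (f : Lp ℂ 2 μ) (hf : f ≠ 0) :
    IsCompact (ambiguityMaxSet f) := by
  obtain ⟨K, hK, hKf⟩ := exists_isCompact_fst_mem f hf
  have hU : {u : A | stft f f (u, 1) ≠ 0} ∈ 𝓝 (1 : A) := by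
    refine ((continuous_stft f f).comp (Continuous.prodMk_left 1)).continuousAt.eventually_ne ?_
    change stft f f 1 ≠ 0
    rw [stft_self_one]
    simpa using hf
  obtain ⟨L, hL, hLf⟩ := exists_isCompact_of_eq_one hU
  refine (hK.prod hL).of_isClosed_subset (isClosed_ambiguityMaxSet f) fun z hz =>
    ⟨hKf z hz, hLf z.2 fun u hu => ?_⟩
  obtain ⟨c, hc⟩ := (mem_ambiguityMaxSet_iff hf).1 hz
  -- For `w = (u, 1)` the symplectic form reduces to `z.2 u`.
  simpa [symplectic] using symplectic_eq_one_of_stft_ne_zero hc hu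

theorem exists_isSecondDegreeCharacter (f : Lp ℂ 2 μ) (hf : f ≠ 0) :
    ∃ h : ambiguityMaxSubgroup f hf → Circle,
      (∀ z : ambiguityMaxSubgroup f hf,
        (h z : ℂ) = (((‖f‖ ^ 2)⁻¹ : ℝ) : ℂ) * stft f f z) ∧
      IsSecondDegreeCharacter (phaseHom (ambiguityMaxSubgroup f hf)) h := by
  have hn : ‖f‖ ^ 2 ≠ 0 := by simpa using hf
  have h1 (z : ambiguityMaxSubgroup f hf) :
      (((‖f‖ ^ 2)⁻¹ : ℝ) : ℂ) * stft f f z ∈ Submonoid.unitSphere ℂ := by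
    refine mem_sphere_zero_iff_norm.2 ?_
    rw [norm_mul, mem_ambiguityMaxSet_iff_norm_eq.1 z.2, Complex.norm_real,
      Real.norm_of_nonneg (by positivity), inv_mul_cancel₀ hn]
  refine ⟨fun z => ⟨_, h1 z⟩, fun z => rfl, ?_, ?_, fun z w => ?_⟩
  -- Symmetry of `phaseHom` is precisely isotropy.
  · intro z w
    have := isIsotropic_ambiguityMaxSubgroup f hf z z.2 w w.2
    rw [symplectic, mul_inv_eq_one] at this
    apply Circle.ext
    rw [phaseHom_apply, phaseHom_apply, this]
  · exact (continuous_const.mul ((continuous_stft f f).comp continuous_subtype_val)).subtype_mk _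
  · obtain ⟨c, hc⟩ := mem_ambiguityMaxSubgroup.1 z.2
    apply Circle.ext
    change _ * stft f f ((z : A × PontryaginDual A) * w) = (_ * stft f f z) * (_ * stft f f w) *
      (phaseHom (ambiguityMaxSubgroup f hf) w z : ℂ)
    rw [phaseHom_apply, mul_comm (z : A × PontryaginDual A), stft_mul_of_tfShift_eq_smul hf hc]
    ring

omit [LocallyCompactSpace A] [μ.Regular] in
theorem norm_stft_mul {f : Lp ℂ 2 μ} (hf : f ≠ 0) {z : A × PontryaginDual A}
    (hz : z ∈ ambiguityMaxSet f) (w : A × PontryaginDual A) :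
    ‖stft f f (w * z)‖ = ‖stft f f w‖ := by
  obtain ⟨c, hc⟩ := (mem_ambiguityMaxSet_iff hf).1 hz
  have hn : ‖f‖ ^ 2 ≠ 0 := by simpa using hf
  rw [stft_mul_of_tfShift_eq_smul hf hc, norm_mul, norm_mul, norm_mul, RCLike.norm_conj,
    Circle.norm_coe, mem_ambiguityMaxSet_iff_norm_eq.1 hz, Complex.norm_real,
    Real.norm_of_nonneg (by positivity), inv_mul_cancel₀ hn, one_mul, mul_one]

end Continuity

end TimeFrequency

theorem proposition4p1 {A : Type*} [CommGroup A] [TopologicalSpace A] [IsTopologicalGroup A]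
    [LocallyCompactSpace A] [T2Space A] [MeasurableSpace A] [BorelSpace A]
    (μ : Measure A) [μ.IsHaarMeasure] [μ.Regular]
    (f : Lp ℂ 2 μ) (hf : f ≠ 0) :
    -- the maximum of `|V_f f|` is `V_f f (0) = ‖f‖²`
    TimeFrequency.stft f f 1 = ((‖f‖ ^ 2 : ℝ) : ℂ) ∧
    (∀ z : A × PontryaginDual A, ‖TimeFrequency.stft f f z‖ ≤ ‖f‖ ^ 2) ∧
    ∃ G : Subgroup (A × PontryaginDual A),
      (G : Set (A × PontryaginDual A)) = TimeFrequency.ambiguityMaxSet f ∧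
      IsCompact (G : Set (A × PontryaginDual A)) ∧
      TimeFrequency.IsIsotropic G ∧
      -- the restriction of `‖f‖⁻² V_f f` to `G` is a character of second degree
      (∃ h : G → Circle,
        (∀ z : G, (h z : ℂ) = (((‖f‖ ^ 2)⁻¹ : ℝ) : ℂ) * TimeFrequency.stft f f z) ∧
        TimeFrequency.IsSecondDegreeCharacter (TimeFrequency.phaseHom G) h) ∧
      -- the functional equation, with `z = (x, ξ)` and `w = (y, η)`
      (∀ z ∈ G, ∀ w : A × PontryaginDual A,
        TimeFrequency.stft f f (w * z) =
          (((‖f‖ ^ 2)⁻¹ : ℝ) : ℂ) * TimeFrequency.stft f f z * TimeFrequency.stft f f w *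
            conj (w.2 z.1 : ℂ)) ∧
      -- `|V_f f|` is constant on every coset of `G`
      (∀ a : A × PontryaginDual A,
        ∀ w ∈ a • (G : Set (A × PontryaginDual A)), ∀ w' ∈ a • (G : Set (A × PontryaginDual A)),
          ‖TimeFrequency.stft f f w‖ = ‖TimeFrequency.stft f f w'‖) := by
  refine ⟨TimeFrequency.stft_self_one f, fun z => ?_,
    TimeFrequency.ambiguityMaxSubgroup f hf, rfl, TimeFrequency.isCompact_ambiguityMaxSet f hf,
    TimeFrequency.isIsotropic_ambiguityMaxSubgroup f hf,
    TimeFrequency.exists_isSecondDegreeCharacter f hf, fun z hz w => ?_, ?_⟩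
  · simpa only [pow_two] using TimeFrequency.norm_stft_le f f z
  · obtain ⟨c, hc⟩ := TimeFrequency.mem_ambiguityMaxSubgroup.1 hz
    exact TimeFrequency.stft_mul_of_tfShift_eq_smul hf hc w
  · rintro a _ ⟨z, hz, rfl⟩ _ ⟨z', hz', rfl⟩
    change ‖TimeFrequency.stft f f (a * z)‖ = ‖TimeFrequency.stft f f (a * z')‖
    rw [TimeFrequency.norm_stft_mul hf hz, TimeFrequency.norm_stft_mul hf hz']
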